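/- Let $R$ be a ring. The rank of a matrix over $R$ is the least $k$ such that the matrix is a sum of $k$ outer products (column vector times row vector); over a field this is the usual rank. For $f:\{0,1\}^{2n}\to R$, the truth table matrix $M_f$ is the $2^n\times 2^n$ matrix indexed by $x,y\in\{0,1\}^n$ with $M_f(x,y)=f(x,y)$. A function on $\{0,1\}^n$ is symmetric if its value is unchanged under every permutation of its $n$ inputs. (1) For all sufficiently small $\varepsilon>0$ there is a $\delta<1$, depending only on $\varepsilon$, such that for every ring $R$, every $n\ge 0$ and every symmetric function $f:\{0,1\}^n\to R$, the truth table matrix of the function $IP_f:\{0,1\}^{2n}\to R$, $IP_f(x,y)=f(x_1\wedge y_1,\ldots,x_n\wedge y_n)$, differs in at most $2^{(1+\varepsilon)n}$ entries from some matrix over $R$ of rank at most $2^{\delta n}$. (2) There is an absolute constant $c>0$ such that the following holds for every ring $R$ and all $n,s\ge 0$. Let $f:\{0,1\}^{2n}\to R$ be computed by a $\mathsf{SYM}\circ\mathsf{AND}$ circuit with $s$ $\mathsf{AND}$ gates, that is, $f(z)=g(a_1(z),\ldots,a_s(z))$ where $g:\{0,1\}^s\to R$ is symmetric and each $a_j$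 is a conjunction of (any number of) variables and negated variables. Then for every integer $r$ with $1\le r\le 2^{2n}$ one can modify at most $2^{2n}/r$ entries of $M_f$ and obtain a matrix of rank at most $$\max\{2,\; s/\log_2 r\}^{\,c\sqrt{s\log_2 r}},$$ where for $r=1$ the bound is read as $1$. In particular, when $s\ge 2\log_2 r>0$, the rank is at most $(s/\log_2 r)^{c\sqrt{s\log_2 r}}$. -/

import Mathlib

/-- The rank of a matrix over a ring: the least number `k` of outer products (column vector times
row vector) of which it is the sum, i.e. the least inner dimension of a factorization `M = A * B`.
Over a field it is the usual rank, see `factorRank_eq_rank`. -/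
noncomputable def factorRank {m p R : Type*} [Ring R] (M : Matrix m p R) : ℕ :=
  sInf {k : ℕ | ∃ (A : Matrix m (Fin k) R) (B : Matrix (Fin k) p R), M = A * B}

theorem factorRank_eq_rank {m p K : Type*} [Fintype m] [Fintype p] [Field K]
    (M : Matrix m p K) : factorRank M = M.rank := by
  classical
  have hmem : M.rank ∈ {k : ℕ | ∃ (A : Matrix m (Fin k) K) (B : Matrix (Fin k) p K),
      M = A * B} := by
    let b : Module.Basis (Fin M.rank) K (LinearMap.range M.mulVecLin) :=
      Module.finBasis K (LinearMap.range M.mulVecLin)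
    let c : p → LinearMap.range M.mulVecLin :=
      fun j => ⟨M.mulVecLin (Pi.single j 1), LinearMap.mem_range_self _ _⟩
    refine ⟨Matrix.of fun i k => (b k : m → K) i, Matrix.of fun k j => b.repr (c j) k, ?_⟩
    ext i j
    have h := congrArg (fun v : LinearMap.range M.mulVecLin => (v : m → K) i)
      (b.sum_repr (c j))
    simp only [Submodule.coe_sum, Submodule.coe_smul, Finset.sum_apply, Pi.smul_apply,
      smul_eq_mul] at h
    simp only [Matrix.mul_apply, Matrix.of_apply]
    have h2 : ((c j : LinearMap.range M.mulVecLin) : m → K) i = M i j := by simp [c]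
    rw [← h2, ← h]
    exact Finset.sum_congr rfl fun _ _ => mul_comm _ _
  refine le_antisymm (Nat.sInf_le hmem) (le_csInf ⟨_, hmem⟩ ?_)
  rintro k ⟨A, B, rfl⟩
  calc (A * B).rank ≤ A.rank := Matrix.rank_mul_le_left A B
    _ ≤ k := by simpa using A.rank_le_card_width

/-- The number of entries in which two matrices differ. -/
noncomputable def numDiff {m p R : Type*} (M N : Matrix m p R) : ℕ :=
  {e : m × p | M e.1 e.2 ≠ N e.1 e.2}.ncard

/-- A function of `n` bits is symmetric if its value is unchanged under every permutation of its
inputs. -/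
def IsSymmetricFun {n : ℕ} {R : Type*} (f : (Fin n → Bool) → R) : Prop :=
  ∀ (σ : Equiv.Perm (Fin n)) (x : Fin n → Bool), f (fun i => x (σ i)) = f x

/-- The truth table matrix of a function of `2n` bits `(x, y)`: rows are indexed by
`x ∈ {0,1}ⁿ` and columns by `y ∈ {0,1}ⁿ`. -/
def truthTable {n : ℕ} {R : Type*} (f : (Fin n ⊕ Fin n → Bool) → R) :
    Matrix (Fin n → Bool) (Fin n → Bool) R :=
  Matrix.of fun x y => f (Sum.elim x y)

/-- `IP_f(x, y) = f (x₁ ∧ y₁, …, xₙ ∧ yₙ)`. -/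
def innerProductFun {n : ℕ} {R : Type*} (f : (Fin n → Bool) → R) :
    (Fin n ⊕ Fin n → Bool) → R :=
  fun z => f (fun i => z (Sum.inl i) && z (Sum.inr i))

/-- An AND gate over the variables `V`, of unbounded fan-in: the conjunction of the variables in
`pos` and the negated variables in `neg`. -/
structure AndGate (V : Type) where
  pos : Finset V
  neg : Finset V

def AndGate.eval {V : Type} (g : AndGate V) (z : V → Bool) : Bool :=
  decide ((∀ i ∈ g.pos, z i = true) ∧ (∀ i ∈ g.neg, z i = false))

/-- A depth-two `SYM ∘ AND` circuit over the variables `V` with `s` AND gates in the hidden layer,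
whose output gate is a symmetric function of the `s` bits that they compute. -/
structure SymAndCircuit (V : Type) (s : ℕ) (R : Type*) where
  gate : Fin s → AndGate V
  top : (Fin s → Bool) → R
  top_symm : IsSymmetricFun top

def SymAndCircuit.eval {V : Type} {s : ℕ} {R : Type*} (C : SymAndCircuit V s R)
    (z : V → Bool) : R :=
  C.top (fun j => (C.gate j).eval z)

-- Both halves replace a symmetric function by a multilinear polynomial of low degree in bits of the
-- form (row condition) ∧ (column condition). A monomial in such bits is an outer product, so the
-- rank is at most the number of monomials (`factorRank_multilinearEval_le`). The interpolation
-- involves no division, which is why every ring is allowed.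
--
-- For `IP_f`, a polynomial of degree below n/2 matches f on all weights from 3an up to the largest
-- balanced weight. Rows and columns of unbalanced weight are few and are corrected exactly. At an
-- entry still wrong, x and y are balanced and x ∧ y is light, hence ¬x ∧ ¬y is light too; given x,
-- these two sets determine y, so such entries are rare (`exists_innerProduct_approx`).
--
-- For circuits, a symmetric function of s bits is approximated with error 2^(-L) in degree O(√(sL))
-- (`exists_multilinearEval_approx`). A well-chosen half of the bits predicts the total weight up to
-- O(√(sL)). Interpolation on that window has degree O(√(sL)), and its coefficients are a symmetric
-- function of the half, hence are approximated recursively.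

universe u

/-! ### Multilinear polynomials with coefficients in an abelian group -/

/-- The value at the indicator vector of `A` of the multilinear polynomial whose coefficient at the
monomial `∏ i ∈ T, xᵢ` is `c T`. -/
def multilinearEval {ι V : Type*} [AddCommGroup V] (c : Finset ι → V) (A : Finset ι) : V :=
  ∑ T ∈ A.powerset, c T

/-- Discrete integration: the coefficients for the forward difference of `g`, shifted by one index,
serve for `g` up to the constant term. Only integer combinations occur. -/
theorem exists_newton_interpolation {V : Type*} [AddCommGroup V] (lo d : ℕ) (g : ℕ → V) :
    ∃ b : ℕ → V, (∀ j, d < j → b j = 0) ∧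
      ∀ m, lo ≤ m → m ≤ lo + d → ∑ j ∈ Finset.range (m + 1), m.choose j • b j = g m := by
  induction d generalizing g with
  | zero =>
    refine ⟨fun j => if j = 0 then g lo else 0, fun j hj => if_neg (by omega), fun m h1 h2 => ?_⟩
    obtain rfl : m = lo := by omega
    simp [Finset.sum_ite_eq']
  | succ d ih =>
    obtain ⟨b, hb, hbm⟩ := ih (fun m => g (m + 1) - g m)
    let P : ℕ → V := fun m => ∑ j ∈ Finset.range m, m.choose (j + 1) • b j
    have hP : ∀ m, P (m + 1) = P m + ∑ j ∈ Finset.range (m + 1), m.choose j • b j := by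
      intro m
      have h : P m = ∑ j ∈ Finset.range (m + 1), m.choose (j + 1) • b j := by
        simp [P, Finset.sum_range_succ]
      rw [h, ← Finset.sum_add_distrib]
      refine Finset.sum_congr rfl fun j _ => ?_
      rw [Nat.choose_succ_succ, add_smul, add_comm]
    refine ⟨fun j => Nat.casesOn j (g lo - P lo) b, ?_, ?_⟩
    · rintro (_ | j) hj
      · omega
      · exact hb j (by omega)
    · have key : ∀ k, k ≤ d + 1 → P (lo + k) + (g lo - P lo) = g (lo + k) := by
        intro k
        induction k with
        | zero => intro _; simp
        | succ k ihk =>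
          intro hk
          have h1 := ihk (by omega)
          have h2 := hbm (lo + k) (by omega) (by omega)
          rw [← add_assoc, hP, h2]
          rw [← h1]
          have h3 : g (lo + k + 1) = g (lo + k) + (g (lo + k + 1) - g (lo + k)) := by abel
          rw [h3, ← h1]
          abel
      intro m h1 h2
      obtain ⟨k, rfl⟩ := Nat.exists_eq_add_of_le h1
      rw [Finset.sum_range_succ', ← key k (by omega)]
      simp [P]

/-- On the points of weight `lo, …, lo + d` within `S`, a symmetric function of the bits in `S` is
a polynomial of degree at most `d`. -/
theorem exists_multilinearEval_eq {ι V : Type*} [DecidableEq ι] [AddCommGroup V] (S : Finset ι)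
    (lo d : ℕ) (g : ℕ → V) :
    ∃ c : Finset ι → V, (∀ T, d < T.card → c T = 0) ∧
      ∀ A : Finset ι, lo ≤ (S ∩ A).card → (S ∩ A).card ≤ lo + d →
        multilinearEval c A = g (S ∩ A).card := by
  obtain ⟨b, hb, hbm⟩ := exists_newton_interpolation lo d g
  refine ⟨fun T => if T ⊆ S then b T.card else 0, fun T hT => ?_, fun A h1 h2 => ?_⟩
  · simp [hb _ hT]
  · rw [← hbm _ h1 h2, ← Finset.sum_powerset_apply_card, multilinearEval, ← Finset.sum_filter]
    refine Finset.sum_congr ?_ fun _ _ => rfl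
    ext T
    simp only [Finset.mem_filter, Finset.mem_powerset, Finset.subset_inter_iff, and_comm]

/-- Bits are idempotent, so the product of the monomials `T` and `U` is the monomial `T ∪ U`, and
degrees add. -/
theorem exists_multilinearEval_comp {ι V : Type*} [DecidableEq ι] [AddCommGroup V] {d₁ d₂ : ℕ}
    (c : Finset ι → Finset ι → V) (h₁ : ∀ T, d₁ < T.card → c T = 0)
    (h₂ : ∀ T U, d₂ < U.card → c T U = 0) :
    ∃ e : Finset ι → V, (∀ T, d₁ + d₂ < T.card → e T = 0) ∧
      ∀ A, multilinearEval e A = multilinearEval (multilinearEval c A) A := by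
  refine ⟨fun T => ∑ p ∈ (T.powerset ×ˢ T.powerset).filter (fun p => p.1 ∪ p.2 = T), c p.1 p.2,
    fun T hT => Finset.sum_eq_zero fun p hp => ?_, fun A => ?_⟩
  · obtain ⟨-, rfl⟩ := Finset.mem_filter.1 hp
    have := Finset.card_union_le p.1 p.2
    rcases lt_or_ge d₁ p.1.card with h | h
    · rw [h₁ _ h]; rfl
    · exact h₂ _ _ (by omega)
  · have h : multilinearEval (multilinearEval c A) A
        = ∑ p ∈ A.powerset ×ˢ A.powerset, c p.1 p.2 := by
      simp only [multilinearEval, Finset.sum_apply]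
      rw [Finset.sum_comm, Finset.sum_product]
    rw [h, ← Finset.sum_fiberwise_of_maps_to (t := A.powerset) (g := fun p => p.1 ∪ p.2)]
    · refine Finset.sum_congr rfl fun T hT => Finset.sum_congr ?_ fun _ _ => rfl
      ext p
      simp only [Finset.mem_filter, Finset.mem_product, Finset.mem_powerset] at hT ⊢
      constructor
      · rintro ⟨⟨h1, h2⟩, h3⟩
        exact ⟨⟨h1.trans hT, h2.trans hT⟩, h3⟩
      · rintro ⟨-, rfl⟩
        exact ⟨⟨Finset.subset_union_left, Finset.subset_union_right⟩, rfl⟩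
    · intro p hp
      simp only [Finset.mem_product, Finset.mem_powerset] at hp ⊢
      exact Finset.union_subset hp.1 hp.2

/-! ### Small sets and concentration of random halves -/

/-- The number of sets of size at most `m` is at most `(1 + t) ^ n / t ^ m`. -/
theorem card_small_mul_rpow_le {ι : Type*} [Fintype ι] (t m : ℝ)
    (ht : 0 < t) (ht1 : t ≤ 1) :
    (((Finset.univ : Finset (Finset ι)).filter fun T => (T.card : ℝ) ≤ m).card : ℝ) * t ^ m
      ≤ (1 + t) ^ Fintype.card ι := by
  have h := Finset.sum_pow_mul_eq_add_pow t 1 (Finset.univ : Finset ι)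
  simp only [one_pow, mul_one, Finset.powerset_univ, Finset.card_univ] at h
  rw [add_comm, ← h, ← nsmul_eq_mul, ← Finset.sum_const]
  refine (Finset.sum_le_sum fun T hT => ?_).trans
    (Finset.sum_le_sum_of_subset_of_nonneg (Finset.filter_subset _ _) fun _ _ _ => by positivity)
  rw [← Real.rpow_natCast]
  exact Real.rpow_le_rpow_of_exponent_ge ht ht1 (Finset.mem_filter.1 hT).2

/-- The excess of the elements of `A` inside `T` over those outside of `T`, within `S`. -/
def excess {ι : Type*} [DecidableEq ι] (S A T : Finset ι) : ℝ :=
  ((T ∩ A).card : ℝ) - (((S \ T) ∩ A).card : ℝ)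

/-- The sum factors over `S`: each `i ∈ A` gives 2 cosh l ≤ 2 exp(l²/2), every other `i` gives 2. -/
theorem sum_exp_excess_le {ι : Type*} [DecidableEq ι] (S A : Finset ι) (l : ℝ) :
    ∑ T ∈ S.powerset, Real.exp (l * excess S A T)
      ≤ 2 ^ S.card * Real.exp (l ^ 2 / 2 * S.card) := by
  have h := Finset.prod_add (fun i => if i ∈ A then Real.exp l else 1)
    (fun i => if i ∈ A then Real.exp (-l) else 1) S
  have h' : ∑ T ∈ S.powerset, Real.exp (l * excess S A T)
      = ∏ i ∈ S, ((if i ∈ A then Real.exp l else 1) + if i ∈ A then Real.exp (-l) else 1) := by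
    rw [h]
    refine Finset.sum_congr rfl fun T _ => ?_
    rw [Finset.prod_ite, Finset.prod_ite]
    simp only [Finset.prod_const, one_pow, mul_one, Finset.filter_mem_eq_inter]
    rw [← Real.exp_nat_mul, ← Real.exp_nat_mul, ← Real.exp_add, excess]
    congr 1
    ring
  rw [h', mul_comm (l ^ 2 / 2), Real.exp_nat_mul, ← mul_pow, ← Finset.prod_const]
  refine Finset.prod_le_prod (fun i _ => by split_ifs <;> positivity) fun i _ => ?_
  split_ifs
  · have := Real.cosh_le_exp_half_sq l
    rw [Real.cosh_eq] at this
    linarith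
  · have : (1 : ℝ) ≤ Real.exp (l ^ 2 / 2) := Real.one_le_exp (by positivity)
    linarith

/-- Chernoff's method with the optimal parameter `a / #S`; the two signs of `l` treat the two tails.
-/
theorem card_excess_gt_le {ι : Type*} [DecidableEq ι] (S A : Finset ι) (hS : S.Nonempty) (a : ℝ)
    (ha : 0 ≤ a) :
    ((S.powerset.filter fun T => a < |excess S A T|).card : ℝ)
      ≤ 2 ^ S.card * (2 * Real.exp (-(a ^ 2 / (2 * S.card)))) := by
  have hN : (0 : ℝ) < S.card := by exact_mod_cast hS.card_pos
  set l : ℝ := a / S.card with hl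
  have hl0 : 0 ≤ l := by positivity
  have h1 := sum_exp_excess_le S A l
  have h2 := sum_exp_excess_le S A (-l)
  have h3 : ((S.powerset.filter fun T => a < |excess S A T|).card : ℝ) * Real.exp (l * a)
      ≤ ∑ T ∈ S.powerset, (Real.exp (l * excess S A T) + Real.exp (-l * excess S A T)) := by
    rw [← nsmul_eq_mul, ← Finset.sum_const]
    refine (Finset.sum_le_sum fun T hT => ?_).trans
      (Finset.sum_le_sum_of_subset_of_nonneg (Finset.filter_subset _ _) fun _ _ _ => by positivity)
    have hT := (Finset.mem_filter.1 hT).2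
    rcases lt_abs.1 hT with h | h
    · have : Real.exp (l * a) ≤ Real.exp (l * excess S A T) :=
        Real.exp_le_exp.2 (mul_le_mul_of_nonneg_left h.le hl0)
      have := Real.exp_pos (-l * excess S A T)
      linarith
    · have : Real.exp (l * a) ≤ Real.exp (-l * excess S A T) :=
        Real.exp_le_exp.2 (by nlinarith)
      have := Real.exp_pos (l * excess S A T)
      linarith
  rw [Finset.sum_add_distrib] at h3
  rw [neg_sq] at h2
  have h4 : Real.exp (-(a ^ 2 / (2 * S.card))) * Real.exp (l * a)
      = Real.exp (l ^ 2 / 2 * S.card) := by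
    rw [← Real.exp_add]
    congr 1
    rw [hl]
    field_simp
    ring
  refine le_of_mul_le_mul_right ?_ (Real.exp_pos (l * a))
  calc _ ≤ _ := h3
    _ ≤ 2 ^ S.card * (2 * Real.exp (l ^ 2 / 2 * S.card)) := by linarith
    _ = _ := by rw [← h4]; ring

/-- Some subset of at most half of `S` gives, up to a deviation `a`, half of `#(S ∩ A ω)` for most
of the `ω`. -/
theorem exists_half_sample {ι Ω : Type*} [DecidableEq ι] [Fintype Ω] (A : Ω → Finset ι)
    (S : Finset ι) (hS : S.Nonempty) (a : ℝ) (ha : 0 ≤ a) :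
    ∃ T ⊆ S, 2 * T.card ≤ S.card ∧
      (((Finset.univ : Finset Ω).filter fun ω =>
        a < |2 * ((T ∩ A ω).card : ℝ) - ((S ∩ A ω).card : ℝ)|).card : ℝ)
      ≤ 2 * Real.exp (-(a ^ 2 / (2 * S.card))) * Fintype.card Ω := by
  set B : ℝ := 2 * Real.exp (-(a ^ 2 / (2 * S.card)))
  -- Few `T` are bad for each `ω`, so averaging gives one `T` that is bad for few `ω`.
  have h1 : ∃ T ∈ S.powerset, (((Finset.univ : Finset Ω).filter fun ω =>
      a < |excess S (A ω) T|).card : ℝ) ≤ B * Fintype.card Ω := by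
    refine Finset.exists_le_of_sum_le ⟨∅, Finset.empty_mem_powerset S⟩ ?_
    have h2 : ∀ T, (((Finset.univ : Finset Ω).filter fun ω => a < |excess S (A ω) T|).card : ℝ)
        = ∑ ω : Ω, if a < |excess S (A ω) T| then (1 : ℝ) else 0 := fun T => by simp
    simp only [h2]
    rw [Finset.sum_comm, Finset.sum_const, Finset.card_powerset, nsmul_eq_mul]
    calc _ ≤ ∑ ω : Ω, (2 : ℝ) ^ S.card * B := by
          refine Finset.sum_le_sum fun ω _ => ?_
          rw [Finset.sum_boole]
          exact card_excess_gt_le S (A ω) hS a ha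
      _ = _ := by
          rw [Finset.sum_const, nsmul_eq_mul, Finset.card_univ]
          push_cast
          ring
  obtain ⟨T, hT, hTB⟩ := h1
  have hTS := Finset.mem_powerset.1 hT
  have hex : ∀ ω, ((T ∩ A ω).card : ℝ) + (((S \ T) ∩ A ω).card : ℝ) = ((S ∩ A ω).card : ℝ) := by
    intro ω
    have : S ∩ A ω = (T ∩ A ω) ∪ ((S \ T) ∩ A ω) := by
      rw [← Finset.union_inter_distrib_right, Finset.union_sdiff_of_subset hTS]
    rw [this, Finset.card_union_of_disjoint]
    · push_cast; ring
    · exact Finset.disjoint_sdiff.mono Finset.inter_subset_left Finset.inter_subset_left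
  have hcard := Finset.card_sdiff_add_card_eq_card hTS
  -- `T` and `S \ T` have opposite excess, so the smaller of the two can be taken.
  rcases le_total (2 * T.card) S.card with h | h
  · have h2 : ∀ ω, 2 * ((T ∩ A ω).card : ℝ) - ((S ∩ A ω).card : ℝ) = excess S (A ω) T :=
      fun ω => by rw [excess, ← hex ω]; ring
    exact ⟨T, hTS, h, by simpa only [h2] using hTB⟩
  · have h2 : ∀ ω, 2 * (((S \ T) ∩ A ω).card : ℝ) - ((S ∩ A ω).card : ℝ)
        = -excess S (A ω) T :=
      fun ω => by rw [excess, ← hex ω]; ring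
    exact ⟨S \ T, Finset.sdiff_subset, by omega, by simpa only [h2, abs_neg] using hTB⟩

/-! ### Low-degree approximation of symmetric functions -/

/-- Since `2 ≤ L`, M(L + 1) ≤ (3/4)NL; the constant 26 works because 26·√(3/4) + 2·√2.8 ≤ 26. -/
theorem degree_recursion_bound {N M L a d : ℝ} (hN : 0 ≤ N) (hM : 2 * M ≤ N)
    (hL : 2 ≤ L) (ha : a = √(2 * N * ((L + 2) * Real.log 2))) (hd : d ≤ 26 * √(M * (L + 1))) :
    d + 2 * a ≤ 26 * √(N * L) := by
  have hlog : Real.log 2 ≤ 0.7 := by have := Real.log_two_lt_d9; linarith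
  have hlog0 : 0 < Real.log 2 := Real.log_pos one_lt_two
  have hNL : 0 ≤ N * L := by positivity
  have h1 : a ≤ 1.674 * √(N * L) := by
    rw [ha, ← Real.sqrt_sq (by norm_num : (0 : ℝ) ≤ 1.674), ← Real.sqrt_mul (by norm_num)]
    refine Real.sqrt_le_sqrt ?_
    have : (L + 2) * Real.log 2 ≤ 2 * L * 0.7 := by gcongr; linarith
    nlinarith
  have h2 : √(M * (L + 1)) ≤ 0.8661 * √(N * L) := by
    rw [← Real.sqrt_sq (by norm_num : (0 : ℝ) ≤ 0.8661), ← Real.sqrt_mul (by norm_num)]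
    refine Real.sqrt_le_sqrt ?_
    have : M * (L + 1) ≤ N / 2 * (3 / 2 * L) := by gcongr <;> linarith
    nlinarith
  have := Real.sqrt_nonneg (N * L)
  linarith

/-- A symmetric function of `N` bits agrees, with error `2 ^ (-L)` under any distribution of the
bits, with a polynomial of degree `O(√(N L))`. -/
theorem exists_multilinearEval_approx {ι : Type} [DecidableEq ι] {Ω : Type*} [Fintype Ω]
    (A : Ω → Finset ι) (S : Finset ι) {V : Type u} [AddCommGroup V] (g : ℕ → V) (L : ℝ)
    (hL : 2 ≤ L) :
    ∃ (d : ℕ) (c : Finset ι → V), (d : ℝ) ≤ 26 * √(S.card * L) ∧ (∀ T, d < T.card → c T = 0) ∧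
      ({ω : Ω | multilinearEval c (A ω) ≠ g (S ∩ A ω).card}.ncard : ℝ)
        ≤ 2 ^ (-L) * Fintype.card Ω := by
  classical
  -- `V` must vary: the recursive call takes values in `Finset ι → V`, which stays in `Type u`
  -- because `ι : Type`.
  induction hn : S.card using Nat.strong_induction_on generalizing S V L with
  | _ n ih =>
  subst hn
  rcases S.eq_empty_or_nonempty with rfl | hS
  · obtain ⟨c, hc, hc'⟩ := exists_multilinearEval_eq (∅ : Finset ι) 0 0 g
    refine ⟨0, c, by simp, hc, ?_⟩
    have : {ω : Ω | multilinearEval c (A ω) ≠ g ((∅ : Finset ι) ∩ A ω).card} = ∅ := by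
      ext ω
      simp only [Set.mem_ofPred_eq, Set.mem_empty_iff_false, iff_false, not_not]
      exact hc' (A ω) (by simp) (by simp)
    rw [this]
    simp only [Set.ncard_empty, Nat.cast_zero]
    positivity
  have hN : (0 : ℝ) < S.card := by exact_mod_cast hS.card_pos
  have hlog0 : 0 < Real.log 2 := Real.log_pos one_lt_two
  -- Makes the sampling error exactly 2^(-(L+1)), half of the budget; the recursive call uses the
  -- other half.
  obtain ⟨a, ha⟩ : ∃ a : ℝ, a = √(2 * S.card * ((L + 2) * Real.log 2)) := ⟨_, rfl⟩
  have ha0 : 0 ≤ a := ha ▸ Real.sqrt_nonneg _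
  obtain ⟨T, hTS, hT2, hT⟩ := exists_half_sample A S hS a ha0
  have hexp : 2 * Real.exp (-(a ^ 2 / (2 * S.card))) = 2 ^ (-(L + 1)) := by
    rw [ha, Real.sq_sqrt (by positivity), Real.rpow_def_of_pos two_pos]
    nth_rewrite 1 [← Real.exp_log two_pos]
    rw [← Real.exp_add]
    congr 1
    field_simp
    ring
  rw [hexp] at hT
  obtain ⟨p, hp⟩ : ∃ p, p = ⌊a⌋₊ := ⟨_, rfl⟩
  -- `h k` interpolates `g` on a window around `2 * k`. Truncated subtraction is harmless: the
  -- window still reaches up to `2 * k + p`.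
  choose h hh hh' using fun k : ℕ => exists_multilinearEval_eq S (2 * k - p) (2 * p) g
  have hTlt : T.card < S.card := by have := hS.card_pos; omega
  obtain ⟨d, e, hd, he, he'⟩ := ih T.card hTlt T h (L + 1) (by linarith) rfl
  -- Where `e` misses `h`, its value may have high degree. Dropping these coefficients bounds the
  -- degree everywhere and changes nothing where `e` equals `h`.
  let e₁ : Finset ι → Finset ι → V := fun T U => if U.card ≤ 2 * p then e T U else 0
  obtain ⟨c, hc, hc'⟩ := exists_multilinearEval_comp (d₁ := d) (d₂ := 2 * p) e₁
    (fun T hT => by funext U; simp [e₁, he T hT])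
    (fun T U hU => if_neg (by omega))
  refine ⟨d + 2 * p, c, ?_, hc, ?_⟩
  · have h1 : (p : ℝ) ≤ a := hp ▸ Nat.floor_le ha0
    have h2 := degree_recursion_bound hN.le (by exact_mod_cast hT2) hL ha hd
    push_cast
    linarith
  · have hsub : {ω : Ω | multilinearEval c (A ω) ≠ g (S ∩ A ω).card}
        ⊆ {ω : Ω | multilinearEval e (A ω) ≠ h (T ∩ A ω).card} ∪
          ↑((Finset.univ : Finset Ω).filter fun ω =>
            a < |2 * ((T ∩ A ω).card : ℝ) - ((S ∩ A ω).card : ℝ)|) := by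
      intro ω hω
      by_contra hcon
      simp only [Set.mem_union, Set.mem_ofPred_eq, Finset.coe_filter, Finset.mem_univ, true_and,
        not_or, not_not, not_lt] at hcon
      obtain ⟨h1, h2⟩ := hcon
      apply hω
      have h3 : multilinearEval e₁ (A ω) = h (T ∩ A ω).card := by
        funext U
        rw [← h1]
        simp only [multilinearEval, Finset.sum_apply, e₁]
        split_ifs with hU
        · rfl
        · have := congrFun h1 U
          rw [hh _ _ (by omega)] at this
          simpa [multilinearEval] using this.symm
      have h4 := abs_le.1 h2
      have h5 : (S ∩ A ω).card ≤ 2 * (T ∩ A ω).card + p := by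
        have : (S ∩ A ω).card - 2 * (T ∩ A ω).card ≤ p := by
          rw [hp]
          refine Nat.le_floor ?_
          rcases le_total (2 * (T ∩ A ω).card) (S ∩ A ω).card with h6 | h6
          · rw [Nat.cast_sub h6]; push_cast; linarith
          · rw [Nat.sub_eq_zero_of_le h6]; simpa using ha0
        omega
      have h6 : 2 * (T ∩ A ω).card ≤ (S ∩ A ω).card + p := by
        have : 2 * (T ∩ A ω).card - (S ∩ A ω).card ≤ p := by
          rw [hp]
          refine Nat.le_floor ?_
          rcases le_total (S ∩ A ω).card (2 * (T ∩ A ω).card) with h6 | h6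
          · rw [Nat.cast_sub h6]; push_cast; linarith
          · rw [Nat.sub_eq_zero_of_le h6]; simpa using ha0
        omega
      rw [hc', h3]
      exact hh' _ (A ω) (by omega) (by omega)
    have hle := (Set.ncard_le_ncard hsub (Set.toFinite _)).trans (Set.ncard_union_le _ _)
    rw [Set.ncard_coe_finset] at hle
    have hle' : ({ω : Ω | multilinearEval c (A ω) ≠ g (S ∩ A ω).card}.ncard : ℝ) ≤ _ :=
      Nat.cast_le.2 hle
    rw [Nat.cast_add] at hle'
    have h2 : (2 : ℝ) ^ (-L) = 2 ^ (-(L + 1)) + 2 ^ (-(L + 1)) := by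
      rw [← two_mul]
      nth_rewrite 2 [← Real.rpow_one 2]
      rw [← Real.rpow_add two_pos]
      congr 1
      ring
    rw [h2, add_mul]
    linarith

/-! ### Rank over a ring -/

theorem factorRank_le_card {m p κ R : Type*} [Ring R] [Fintype κ] (A : Matrix m κ R)
    (B : Matrix κ p R) : factorRank (A * B) ≤ Fintype.card κ := by
  refine Nat.sInf_le ⟨A.submatrix id (Fintype.equivFin κ).symm,
    B.submatrix (Fintype.equivFin κ).symm id, ?_⟩
  rw [Matrix.submatrix_mul_equiv, Matrix.submatrix_id_id]

theorem exists_factorization {m p R : Type*} [Ring R] [Fintype m] [DecidableEq m]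
    (M : Matrix m p R) :
    ∃ (A : Matrix m (Fin (factorRank M)) R) (B : Matrix (Fin (factorRank M)) p R), M = A * B := by
  refine Nat.sInf_mem (s := {k : ℕ | ∃ (A : Matrix m (Fin k) R) (B : Matrix (Fin k) p R),
    M = A * B}) ⟨Fintype.card m, (1 : Matrix m m R).submatrix id (Fintype.equivFin m).symm,
    M.submatrix (Fintype.equivFin m).symm id, ?_⟩
  rw [Matrix.submatrix_mul_equiv, Matrix.submatrix_id_id, Matrix.one_mul]

theorem factorRank_add_le {m p R : Type*} [Ring R] [Fintype m] [DecidableEq m]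
    (M N : Matrix m p R) : factorRank (M + N) ≤ factorRank M + factorRank N := by
  obtain ⟨A, B, h⟩ := exists_factorization M
  obtain ⟨A', B', h'⟩ := exists_factorization N
  have := factorRank_le_card (Matrix.fromCols A A') (Matrix.fromRows B B')
  rw [Matrix.fromCols_mul_fromRows, ← h, ← h'] at this
  simpa using this

theorem factorRank_le_of_rows {m p R : Type*} [Ring R] [DecidableEq m] (s : Finset m)
    (M : Matrix m p R) (h : ∀ i ∉ s, ∀ j, M i j = 0) : factorRank M ≤ s.card := by
  have := factorRank_le_card (κ := s) (R := R)
    (Matrix.of fun (i : m) k => if i = (k : m) then 1 else 0) (Matrix.of fun k j => M k j)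
  rw [Fintype.card_coe] at this
  refine (congrArg factorRank ?_).trans_le this
  ext i j
  simp only [Matrix.mul_apply, Matrix.of_apply, ite_mul, one_mul, zero_mul]
  rw [Finset.sum_coe_sort s (fun k => if i = k then M k j else 0), Finset.sum_ite_eq]
  split_ifs with hi
  · rfl
  · exact h i hi j

theorem factorRank_le_of_cols {m p R : Type*} [Ring R] [DecidableEq p] (s : Finset p)
    (M : Matrix m p R) (h : ∀ j ∉ s, ∀ i, M i j = 0) : factorRank M ≤ s.card := by
  have := factorRank_le_card (κ := s) (R := R)
    (Matrix.of fun i k => M i k) (Matrix.of fun k j => if (k : p) = j then 1 else 0)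
  rw [Fintype.card_coe] at this
  refine (congrArg factorRank ?_).trans_le this
  ext i j
  simp only [Matrix.mul_apply, Matrix.of_apply, mul_ite, mul_one, mul_zero]
  rw [Finset.sum_coe_sort s (fun k => if k = j then M i k else 0), Finset.sum_ite_eq']
  split_ifs with hi
  · rfl
  · exact h j hi i

/-- A polynomial of degree `d` in products of a bit of the row and a bit of the column has rank
at most the number of monomials. -/
theorem factorRank_multilinearEval_le {ι m p R : Type*} [Fintype ι] [DecidableEq ι] [Ring R]
    (c : Finset ι → R) (d : ℕ) (hc : ∀ T, d < T.card → c T = 0) (A : m → Finset ι)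
    (B : p → Finset ι) :
    factorRank (Matrix.of fun x y => multilinearEval c (A x ∩ B y))
      ≤ ((Finset.univ : Finset (Finset ι)).filter fun T => T.card ≤ d).card := by
  set s := (Finset.univ : Finset (Finset ι)).filter fun T => T.card ≤ d with hs
  have := factorRank_le_card (κ := s) (R := R)
    (Matrix.of fun (x : m) T => if (T : Finset ι) ⊆ A x then 1 else 0)
    (Matrix.of fun T (y : p) => if (T : Finset ι) ⊆ B y then c T else 0)
  rw [Fintype.card_coe] at this
  refine (congrArg factorRank ?_).trans_le this
  ext x y
  simp only [Matrix.mul_apply, Matrix.of_apply, ite_mul, one_mul, zero_mul]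
  rw [Finset.sum_coe_sort s
    (fun T => if T ⊆ A x then if T ⊆ B y then c T else 0 else 0), hs, Finset.sum_filter,
    multilinearEval, ← Finset.filter_subset_univ, Finset.sum_filter]
  refine Finset.sum_congr rfl fun T _ => ?_
  by_cases hT : T.card ≤ d
  · by_cases h1 : T ⊆ A x <;> by_cases h2 : T ⊆ B y <;>
      simp [hT, h1, h2, Finset.subset_inter_iff]
  · simp [hT, hc T (by omega)]

/-! ### Circuits with a symmetric top gate -/

/-- The set of the positions of the ones. -/
def onesOf {ι : Type*} [Fintype ι] (x : ι → Bool) : Finset ι :=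
  Finset.univ.filter fun i => x i = true

/-- A bijection between the ones of two inputs of equal weight extends to a permutation of all
positions. -/
theorem IsSymmetricFun.exists_weight {n : ℕ} {R : Type*} {f : (Fin n → Bool) → R}
    (hf : IsSymmetricFun f) : ∃ g : ℕ → R, ∀ x, f x = g (onesOf x).card := by
  have key : ∀ x y : Fin n → Bool, (onesOf x).card = (onesOf y).card → f x = f y := by
    intro x y h
    let e : {i // x i = true} ≃ {i // y i = true} := Fintype.equivOfCardEq (by
      rw [Fintype.card_subtype, Fintype.card_subtype]
      exact h)
    rw [← hf e.extendSubtype y]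
    congr 1
    funext i
    cases hx : x i with
    | true => exact (e.extendSubtype_mem i hx).symm
    | false =>
      have := e.extendSubtype_not_mem i (by simp [hx])
      exact (Bool.eq_false_iff.2 this).symm
  refine ⟨fun k => if h : ∃ x, (onesOf x).card = k then f h.choose else f fun _ => false,
    fun x => ?_⟩
  have h : ∃ y : Fin n → Bool, (onesOf y).card = (onesOf x).card := ⟨x, rfl⟩
  simp only
  rw [dif_pos h]
  exact key _ _ h.choose_spec.symm

/-- Applied with q = s/L, where √(s·(s/q)) = √(sL) = s/√q. For q ≤ 2 all 2^s sets are counted;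
otherwise `card_small_mul_rpow_le` with t = 1/√q gives the bound. -/
theorem card_small_mul_le {s : ℕ} {q : ℝ} (hq : 0 < q) (hs : 0 < s) (d : ℕ) (k : ℝ)
    (hk : 1 ≤ k) (hd : (d : ℝ) ≤ k * √((s : ℝ) * (s / q))) :
    (((Finset.univ : Finset (Finset (Fin s))).filter fun T => T.card ≤ d).card : ℝ)
      ≤ max 2 q ^ ((k / 2 + 2) * √((s : ℝ) * (s / q))) := by
  have hs' : (0 : ℝ) < s := by exact_mod_cast hs
  have hw : √((s : ℝ) * (s / q)) = s / √q := by
    rw [← mul_div_assoc, ← sq, Real.sqrt_div (sq_nonneg _), Real.sqrt_sq hs'.le]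
  rw [hw] at hd ⊢
  have hq2 : 0 < √q := Real.sqrt_pos.2 hq
  rcases le_total q 2 with h | h
  · rw [max_eq_left h]
    have h1 : (((Finset.univ : Finset (Finset (Fin s))).filter fun T => T.card ≤ d).card : ℝ)
        ≤ 2 ^ (s : ℝ) := by
      rw [Real.rpow_natCast]
      have := Finset.card_filter_le (Finset.univ : Finset (Finset (Fin s)))
        fun T => T.card ≤ d
      rw [Finset.card_univ, Fintype.card_finset, Fintype.card_fin] at this
      exact_mod_cast this
    refine h1.trans (Real.rpow_le_rpow_of_exponent_le one_le_two ?_)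
    have h2 : √q ≤ 2 := (Real.sqrt_le_left two_pos.le).2 (by linarith)
    rw [← mul_div_assoc, le_div_iff₀ hq2]
    nlinarith
  · rw [max_eq_right h]
    have ht1 : 1 / √q ≤ 1 := by
      rw [div_le_one hq2]
      exact Real.one_le_sqrt.2 (by linarith)
    have h1 := card_small_mul_rpow_le (ι := Fin s) (1 / √q) d (by positivity) ht1
    rw [Fintype.card_fin] at h1
    simp only [Nat.cast_le] at h1
    have h2 : (1 + 1 / √q) ^ s ≤ Real.exp (s / √q) := by
      calc (1 + 1 / √q) ^ s ≤ Real.exp (1 / √q) ^ s := by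
            gcongr
            rw [add_comm]
            exact Real.add_one_le_exp _
        _ = _ := by rw [← Real.exp_nat_mul, mul_one_div]
    have hlq : 0.69 ≤ Real.log q :=
      (by have := Real.log_two_gt_d9; linarith : 0.69 ≤ Real.log 2).trans
        (Real.log_le_log two_pos h)
    have h3 : (1 / √q) ^ (d : ℝ) = Real.exp (-(Real.log q / 2 * d)) := by
      rw [Real.rpow_def_of_pos (by positivity), Real.log_div one_ne_zero hq2.ne', Real.log_one,
        Real.log_sqrt hq.le]
      congr 1
      ring
    rw [h3] at h1
    refine le_of_mul_le_mul_right (h1.trans (h2.trans ?_)) (Real.exp_pos _)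
    rw [Real.rpow_def_of_pos hq, ← Real.exp_add]
    refine Real.exp_le_exp.2 ?_
    have hw0 : 0 < s / √q := by positivity
    nlinarith [mul_le_mul_of_nonneg_left hd (by linarith : 0 ≤ Real.log q)]

/-- The conjunctions of a set of AND gates split into a row and a column condition. -/
theorem onesOf_gates_eq_inter {n s : ℕ} (gate : Fin s → AndGate (Fin n ⊕ Fin n))
    (x y : Fin n → Bool) :
    onesOf (fun j => (gate j).eval (Sum.elim x y)) =
      onesOf (fun j => decide ((∀ i, Sum.inl i ∈ (gate j).pos → x i = true) ∧
        ∀ i, Sum.inl i ∈ (gate j).neg → x i = false)) ∩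
      onesOf (fun j => decide ((∀ i, Sum.inr i ∈ (gate j).pos → y i = true) ∧
        ∀ i, Sum.inr i ∈ (gate j).neg → y i = false)) := by
  ext j
  simp only [onesOf, AndGate.eval, Finset.mem_inter, Finset.mem_filter, Finset.mem_univ, true_and,
    decide_eq_true_eq, Sum.forall, Sum.elim_inl, Sum.elim_inr]
  tauto

theorem numDiff_le_card {n : ℕ} {R : Type*} (M N : Matrix (Fin n → Bool) (Fin n → Bool) R) :
    numDiff M N ≤ 2 ^ (2 * n) := by
  have := Set.ncard_le_card {e : (Fin n → Bool) × (Fin n → Bool) | M e.1 e.2 ≠ N e.1 e.2}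
  rw [Nat.card_eq_fintype_card] at this
  simpa [numDiff, two_mul, pow_add] using this

theorem factorRank_zero {m p R : Type*} [Ring R] : factorRank (0 : Matrix m p R) = 0 :=
  Nat.le_zero.1 (Nat.sInf_le ⟨0, 0, by simp⟩)

theorem symAnd_rigidity {R : Type u} [Ring R] {n s : ℕ} {f : (Fin n ⊕ Fin n → Bool) → R}
    (C : SymAndCircuit (Fin n ⊕ Fin n) s R) (hC : ∀ z, C.eval z = f z) {r : ℕ} (hr : 1 ≤ r) :
    ∃ M : Matrix (Fin n → Bool) (Fin n → Bool) R,
      (numDiff (truthTable f) M : ℝ) ≤ (2 : ℝ) ^ (2 * n) / (r : ℝ) ∧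
      (factorRank M : ℝ) ≤
        (max 2 ((s : ℝ) / Real.logb 2 r)) ^ (24 * √((s : ℝ) * Real.logb 2 r)) := by
  obtain ⟨g, hg⟩ := C.top_symm.exists_weight
  -- For r = 1 every entry may be changed, so the zero matrix will do.
  rcases hr.eq_or_lt with rfl | hr2
  · exact ⟨0, by simpa using mod_cast numDiff_le_card (truthTable f) 0, by
      rw [factorRank_zero, Nat.cast_zero]; positivity⟩
  have hr0 : (0 : ℝ) < r := by exact_mod_cast hr
  obtain ⟨L, hL⟩ : ∃ L, L = Real.logb 2 r := ⟨_, rfl⟩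
  have hL1 : 1 ≤ L := by
    rw [hL, Real.le_logb_iff_rpow_le one_lt_two hr0, Real.rpow_one]
    exact_mod_cast hr2
  have hrL : (2 : ℝ) ^ L = r := by rw [hL, Real.rpow_logb two_pos (by norm_num) hr0]
  rw [← hL]
  let A : (Fin n → Bool) × (Fin n → Bool) → Finset (Fin s) := fun e =>
    onesOf fun j => (C.gate j).eval (Sum.elim e.1 e.2)
  -- The sample space is the set of entries. From r ≥ 2 only `1 ≤ L` follows, so `2 * L` is used to
  -- meet the requirement of at least 2.
  obtain ⟨d, c, hd, hc, hc'⟩ := exists_multilinearEval_approx A Finset.univ g (2 * L)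
    (by linarith)
  refine ⟨Matrix.of fun x y => multilinearEval c (A (x, y)), ?_, ?_⟩
  · have h1 : numDiff (truthTable f) (Matrix.of fun x y => multilinearEval c (A (x, y)))
        = {ω | multilinearEval c (A ω) ≠ g (Finset.univ ∩ A ω).card}.ncard := by
      rw [numDiff]
      congr 1
      ext e
      simp only [Set.mem_ofPred_eq, truthTable, Matrix.of_apply, ← hC, SymAndCircuit.eval, hg,
        Finset.univ_inter, A]
      exact ne_comm
    rw [h1]
    refine hc'.trans ?_
    have h2 : (2 : ℝ) ^ (-(2 * L)) ≤ (r : ℝ)⁻¹ := by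
      rw [← hrL, ← Real.rpow_neg two_pos.le]
      exact Real.rpow_le_rpow_of_exponent_le one_le_two (by linarith)
    have h3 : (Fintype.card ((Fin n → Bool) × (Fin n → Bool)) : ℝ) = 2 ^ (2 * n) := by
      simp [two_mul, pow_add]
    rw [h3, div_eq_inv_mul]
    gcongr
  · have h1 := factorRank_multilinearEval_le c d hc
      (fun x : Fin n → Bool => onesOf (fun j =>
        decide ((∀ i, Sum.inl i ∈ (C.gate j).pos → x i = true) ∧
          ∀ i, Sum.inl i ∈ (C.gate j).neg → x i = false)))
      (fun y : Fin n → Bool => onesOf (fun j =>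
        decide ((∀ i, Sum.inr i ∈ (C.gate j).pos → y i = true) ∧
          ∀ i, Sum.inr i ∈ (C.gate j).neg → y i = false)))
    simp only [← onesOf_gates_eq_inter] at h1
    refine (Nat.cast_le.2 h1).trans ?_
    rcases Nat.eq_zero_or_pos s with rfl | hs
    · have : ((Finset.univ : Finset (Finset (Fin 0))).filter fun T => T.card ≤ d).card ≤ 1 :=
        (Finset.card_filter_le _ _).trans (by simp)
      simpa using this
    have hs' : (0 : ℝ) < s := by exact_mod_cast hs
    -- 40 is above 26·1.5 ≥ 26·√2, and the resulting exponent factor 40/2 + 2 is below 24.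
    have h2 := card_small_mul_le (q := s / L) (by positivity) hs d 40 (by norm_num) ?_
    · rw [div_div_cancel₀ hs'.ne'] at h2
      refine h2.trans (Real.rpow_le_rpow_of_exponent_le (le_max_of_le_left one_le_two) ?_)
      gcongr
      norm_num
    · rw [div_div_cancel₀ hs'.ne']
      rw [Finset.card_univ, Fintype.card_fin] at hd
      have : √((s : ℝ) * (2 * L)) ≤ 1.5 * √(s * L) := by
        rw [← Real.sqrt_sq (by norm_num : (0 : ℝ) ≤ 1.5), ← Real.sqrt_mul (by norm_num)]
        refine Real.sqrt_le_sqrt ?_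
        nlinarith [mul_pos hs' (by linarith : 0 < L)]
      nlinarith [Real.sqrt_nonneg (s * L)]

/-! ### Exponential bounds for the number of small sets -/

/-- The number of subsets of an `n`-element set that have size at most `m`. -/
noncomputable def numSmallSets (n : ℕ) (m : ℝ) : ℕ :=
  ((Finset.univ : Finset (Finset (Fin n))).filter fun T => (T.card : ℝ) ≤ m).card

theorem numSmallSets_le_rpow {a t θ : ℝ} (ht : 0 < t) (ht1 : t ≤ 1)
    (h : Real.log (1 + t) - a * Real.log t ≤ θ * Real.log 2) (n : ℕ) :
    (numSmallSets n (a * n) : ℝ) ≤ 2 ^ (θ * n) := by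
  have h1 := card_small_mul_rpow_le (ι := Fin n) t (a * n) ht ht1
  refine le_of_mul_le_mul_right (h1.trans ?_) (Real.rpow_pos_of_pos ht (a * n))
  rw [Fintype.card_fin, ← Real.rpow_natCast, Real.rpow_def_of_pos ht,
    Real.rpow_def_of_pos two_pos, Real.rpow_def_of_pos (by linarith), ← Real.exp_add]
  refine Real.exp_le_exp.2 ?_
  nlinarith [mul_le_mul_of_nonneg_right h (Nat.cast_nonneg (α := ℝ) n)]

theorem exists_numSmallSets_le {η : ℝ} (hη : 0 < η) :
    ∃ a : ℝ, 0 < a ∧ ∀ n : ℕ, (numSmallSets n (a * n) : ℝ) ≤ 2 ^ (η * n) := by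
  have hl : 0 < Real.log 2 := Real.log_pos one_lt_two
  obtain ⟨t, ht⟩ : ∃ t, t = min 1 (η * Real.log 2 / 2) := ⟨_, rfl⟩
  have ht0 : 0 < t := ht ▸ lt_min one_pos (by positivity)
  have ht1 : t ≤ 1 := ht ▸ min_le_left _ _
  have ht2 : t ≤ η * Real.log 2 / 2 := ht ▸ min_le_right _ _
  have hlt : Real.log t ≤ 0 := Real.log_nonpos ht0.le ht1
  have hpos : 0 < 1 - Real.log t := by linarith
  refine ⟨η * Real.log 2 / 2 / (1 - Real.log t), by positivity,
    numSmallSets_le_rpow ht0 ht1 ?_⟩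
  have h1 : Real.log (1 + t) ≤ t := by
    have := Real.log_le_sub_one_of_pos (by linarith : 0 < 1 + t)
    linarith
  have h2 : η * Real.log 2 / 2 / (1 - Real.log t) * (1 - Real.log t) = η * Real.log 2 / 2 :=
    div_mul_cancel₀ _ hpos.ne'
  have h3 : 0 < η * Real.log 2 / 2 / (1 - Real.log t) := by positivity
  linarith

/-- With t = 1 - a, log(1 + t) falls below log 2 by at least a/2, while the cost (1/2 - a)·a/(1 - a)
is less than a/2. -/
theorem exists_numSmallSets_half_le {a : ℝ} (ha : 0 < a) (ha2 : a ≤ 1 / 2) :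
    ∃ θ : ℝ, θ < 1 ∧ ∀ n : ℕ, (numSmallSets n ((1 / 2 - a) * n) : ℝ) ≤ 2 ^ (θ * n) := by
  have hl : 0 < Real.log 2 := Real.log_pos one_lt_two
  have h0 : 0 < 1 - a := by linarith
  refine ⟨(Real.log 2 - a / 2 + (1 / 2 - a) * (a / (1 - a))) / Real.log 2, ?_,
    numSmallSets_le_rpow (t := 1 - a) h0 (by linarith) ?_⟩
  · rw [div_lt_one hl]
    have : (1 / 2 - a) * (a / (1 - a)) < a / 2 := by
      rw [← mul_div_assoc, div_lt_iff₀ h0]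
      nlinarith
    linarith
  · rw [div_mul_cancel₀ _ hl.ne']
    have h1 : Real.log (1 + (1 - a)) ≤ Real.log 2 - a / 2 := by
      have h2 : 1 + (1 - a) = 2 * (1 - a / 2) := by ring
      rw [h2, Real.log_mul two_ne_zero (by linarith)]
      have := Real.log_le_sub_one_of_pos (by linarith : 0 < 1 - a / 2)
      linarith
    have h3 : -Real.log (1 - a) ≤ a / (1 - a) := by
      rw [← Real.log_inv]
      refine (Real.log_le_sub_one_of_pos (inv_pos.2 h0)).trans_eq ?_
      field_simp
      ring
    have := mul_le_mul_of_nonneg_left h3 (by linarith : 0 ≤ 1 / 2 - a)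
    linarith

/-! ### Inner product functions -/

theorem onesOf_injective {ι : Type*} [Fintype ι] :
    Function.Injective (onesOf : (ι → Bool) → Finset ι) := by
  intro x y h
  funext i
  have := Finset.ext_iff.1 h i
  simpa [onesOf] using this

theorem onesOf_and {ι : Type*} [Fintype ι] [DecidableEq ι] (x y : ι → Bool) :
    onesOf (fun i => x i && y i) = onesOf x ∩ onesOf y := by
  ext i
  simp [onesOf]

theorem numSmallSets_mono (n : ℕ) {a b : ℝ} (h : a ≤ b) : numSmallSets n a ≤ numSmallSets n b :=
  Finset.card_le_card fun T hT => by
    simp only [Finset.mem_filter, Finset.mem_univ, true_and] at hT ⊢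
    exact hT.trans h

theorem card_unbalanced_le (n : ℕ) (a : ℝ) :
    ((Finset.univ : Finset (Fin n → Bool)).filter fun x =>
      ((onesOf x).card : ℝ) ≤ (1 / 2 - a) * n ∨ (1 / 2 + a) * n ≤ (onesOf x).card).card
      ≤ 2 * numSmallSets n ((1 / 2 - a) * n) := by
  rw [Finset.filter_or, two_mul]
  refine (Finset.card_union_le _ _).trans (add_le_add ?_ ?_)
  · refine Finset.card_le_card_of_injOn onesOf (fun x hx => ?_) onesOf_injective.injOn
    simpa using hx
  · refine Finset.card_le_card_of_injOn (fun x => (onesOf x)ᶜ) (fun x hx => ?_)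
      (compl_injective.comp onesOf_injective).injOn
    simp only [Finset.coe_filter, Finset.mem_univ, true_and, Set.mem_ofPred_eq] at hx ⊢
    have := (onesOf x).card_add_card_compl
    rw [Fintype.card_fin] at this
    have : ((onesOf x).card : ℝ) + ((onesOf x)ᶜ.card : ℝ) = n := by exact_mod_cast this
    linarith

/-- Given x, the set x ∩ y determines y inside x, and xᶜ ∩ yᶜ determines it outside. -/
theorem card_pairs_le (n : ℕ) (m : ℝ) :
    {e : (Fin n → Bool) × (Fin n → Bool) | ((onesOf e.1 ∩ onesOf e.2).card : ℝ) ≤ m ∧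
      (((onesOf e.1)ᶜ ∩ (onesOf e.2)ᶜ).card : ℝ) ≤ m}.ncard ≤ 2 ^ n * numSmallSets n m ^ 2 := by
  let s := (Finset.univ : Finset (Finset (Fin n))).filter fun T => (T.card : ℝ) ≤ m
  have hs : ((Finset.univ : Finset (Fin n → Bool)) ×ˢ (s ×ˢ s)).card
      = 2 ^ n * numSmallSets n m ^ 2 := by
    rw [Finset.card_product, Finset.card_product, ← sq]
    simp [numSmallSets, s]
  rw [← hs, ← Set.ncard_coe_finset]
  refine Set.ncard_le_ncard_of_injOn
    (fun e => (e.1, (onesOf e.1 ∩ onesOf e.2, (onesOf e.1)ᶜ ∩ (onesOf e.2)ᶜ)))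
    (fun e he => ?_) ?_ (Finset.finite_toSet _)
  · simpa [s] using he
  · rintro ⟨x, y⟩ - ⟨x', y'⟩ - h
    simp only [Prod.mk.injEq] at h
    obtain ⟨rfl, h1, h2⟩ := h
    have : onesOf y = onesOf y' := by
      ext i
      have h1 := Finset.ext_iff.1 h1 i
      have h2 := Finset.ext_iff.1 h2 i
      simp only [Finset.mem_inter, Finset.mem_compl] at h1 h2
      tauto
    rw [onesOf_injective this]

/-- A matrix of low rank that agrees with `IP_f` except where both `x ∧ y` and `¬ x ∧ ¬ y` have
few ones. -/
theorem exists_innerProduct_approx {R : Type u} [Ring R] {n : ℕ} {f : (Fin n → Bool) → R}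
    (hf : IsSymmetricFun f) {a : ℝ} (ha : 0 < a) (ha4 : a ≤ 1 / 4) :
    ∃ M : Matrix (Fin n → Bool) (Fin n → Bool) R,
      factorRank M ≤ 5 * numSmallSets n ((1 / 2 - a) * n) ∧
      numDiff (truthTable (innerProductFun f)) M ≤ 2 ^ n * numSmallSets n (5 * a * n) ^ 2 := by
  obtain ⟨g, hg⟩ := hf.exists_weight
  have hn : (0 : ℝ) ≤ n := Nat.cast_nonneg n
  have han : 0 ≤ a * n := by positivity
  -- The window runs from 3an to the balanced weight bound (1/2 + a)n, so its length is (1/2 - 2a)n.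
  obtain ⟨lo, hlo⟩ : ∃ lo, lo = ⌈3 * a * n⌉₊ := ⟨_, rfl⟩
  obtain ⟨d, hd⟩ : ∃ d, d = ⌊(1 / 2 - 2 * a) * n⌋₊ := ⟨_, rfl⟩
  obtain ⟨c, hc, hc'⟩ := exists_multilinearEval_eq (Finset.univ : Finset (Fin n)) lo d g
  set F := truthTable (innerProductFun f)
  have hFg : ∀ x y, F x y = g (onesOf x ∩ onesOf y).card := fun x y => by
    rw [← onesOf_and, ← hg]; rfl
  let P : Matrix (Fin n → Bool) (Fin n → Bool) R :=
    Matrix.of fun x y => multilinearEval c (onesOf x ∩ onesOf y)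
  let U := (Finset.univ : Finset (Fin n → Bool)).filter fun x =>
      ((onesOf x).card : ℝ) ≤ (1 / 2 - a) * n ∨ (1 / 2 + a) * n ≤ (onesOf x).card
  have hU : U.card ≤ 2 * numSmallSets n ((1 / 2 - a) * n) := card_unbalanced_le n a
  let E₁ : Matrix (Fin n → Bool) (Fin n → Bool) R :=
    Matrix.of fun x y => if x ∈ U then F x y - P x y else 0
  -- Rows in `U` are left out, since `E₁` already corrects them.
  let E₂ : Matrix (Fin n → Bool) (Fin n → Bool) R :=
    Matrix.of fun x y => if y ∈ U then if x ∈ U then 0 else F x y - P x y else 0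
  refine ⟨P + E₁ + E₂, ?_, ?_⟩
  · have h1 := factorRank_add_le (P + E₁) E₂
    have h2 := factorRank_add_le P E₁
    have h3 : factorRank E₁ ≤ U.card := factorRank_le_of_rows U E₁ fun x hx y => if_neg hx
    have h4 : factorRank E₂ ≤ U.card := factorRank_le_of_cols U E₂ fun y hy x => if_neg hy
    have h5 : factorRank P ≤ numSmallSets n ((1 / 2 - a) * n) := by
      refine (factorRank_multilinearEval_le c d hc onesOf onesOf).trans (Finset.card_le_card ?_)
      intro T hT
      simp only [Finset.mem_filter, Finset.mem_univ, true_and] at hT ⊢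
      rw [hd] at hT
      have h6 := (Nat.cast_le (α := ℝ).2 hT).trans (Nat.floor_le (by nlinarith))
      linarith
    omega
  · refine le_trans (Set.ncard_le_ncard ?_ (Set.toFinite _)) (card_pairs_le n (5 * a * n))
    rintro ⟨x, y⟩ hxy
    simp only [Set.mem_ofPred_eq, Matrix.add_apply] at hxy ⊢
    have hx : x ∉ U := fun hx => hxy (by by_cases hy : y ∈ U <;> simp [E₁, E₂, hx])
    have hy : y ∉ U := fun hy => hxy (by simp [E₁, E₂, hx, hy])
    have hP : P x y ≠ F x y := fun h => hxy (by simp [E₁, E₂, hx, hy, h])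
    simp only [U, Finset.mem_filter, Finset.mem_univ, true_and, not_or, not_le] at hx hy
    have hlt : (onesOf x ∩ onesOf y).card < lo := by
      by_contra hcon
      refine hP ?_
      have h1 := hc' (onesOf x ∩ onesOf y)
      rw [Finset.univ_inter] at h1
      rw [hFg]
      refine h1 (by omega) ?_
      have h2 : (onesOf x ∩ onesOf y).card - lo ≤ d := by
        rw [hd]
        refine Nat.le_floor ?_
        rw [Nat.cast_sub (by omega)]
        have h3 : (3 * a * n : ℝ) ≤ lo := hlo ▸ Nat.le_ceil _
        have h4 : ((onesOf x ∩ onesOf y).card : ℝ) ≤ (onesOf x).card :=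
          Nat.cast_le.2 (Finset.card_le_card Finset.inter_subset_left)
        linarith
      omega
    -- By inclusion-exclusion #(xᶜ ∩ yᶜ) = n - #x - #y + #(x ∩ y) < n - (1 - 2a)n + 3an = 5an.
    rw [hlo, Nat.lt_ceil] at hlt
    have h1 := Finset.card_union_add_card_inter (onesOf x) (onesOf y)
    have h2 := (onesOf x ∪ onesOf y).card_add_card_compl
    rw [Fintype.card_fin, Finset.compl_union] at h2
    have h1' : ((onesOf x ∪ onesOf y).card : ℝ) + ((onesOf x ∩ onesOf y).card : ℝ)
        = (onesOf x).card + (onesOf y).card := by exact_mod_cast h1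
    have h2' : ((onesOf x ∪ onesOf y).card : ℝ) + (((onesOf x)ᶜ ∩ (onesOf y)ᶜ).card : ℝ) = n := by
      exact_mod_cast h2
    constructor <;> linarith

/-- Handles the finitely many n too small to absorb the factor 5 in the rank bound: there a rank
deficit of one suffices. -/
theorem exists_rpow_ge_pred (N : ℕ) :
    ∃ δ : ℝ, δ < 1 ∧ ∀ n : ℕ, 0 < n → n < N → (2 : ℝ) ^ n - 1 ≤ 2 ^ (δ * n) := by
  induction N with
  | zero => exact ⟨0, one_pos, fun n _ h => absurd h (Nat.not_lt_zero n)⟩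
  | succ N ih =>
    obtain ⟨δ, hδ, h⟩ := ih
    rcases Nat.eq_zero_or_pos N with rfl | hN
    · exact ⟨0, one_pos, fun n h1 h2 => by omega⟩
    have hN' : (0 : ℝ) < N := by exact_mod_cast hN
    have h2 : (2 : ℝ) ≤ 2 ^ N := by
      simpa using pow_le_pow_right₀ (one_le_two (α := ℝ)) hN
    have hpos : (0 : ℝ) < 2 ^ N - 1 := by linarith
    refine ⟨max δ (Real.logb 2 (2 ^ N - 1) / N), max_lt hδ ?_, fun n hn hnN => ?_⟩
    · rw [div_lt_one hN', Real.logb_lt_iff_lt_rpow one_lt_two hpos, Real.rpow_natCast]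
      linarith
    · rcases Nat.lt_succ_iff_lt_or_eq.1 hnN with h3 | rfl
      · refine (h n hn h3).trans (Real.rpow_le_rpow_of_exponent_le one_le_two ?_)
        gcongr
        exact le_max_left _ _
      · calc (2 : ℝ) ^ n - 1 = 2 ^ (Real.logb 2 (2 ^ n - 1) / n * n) := by
              rw [div_mul_cancel₀ _ hN'.ne', Real.rpow_logb two_pos (by norm_num) hpos]
          _ ≤ _ := by
              refine Real.rpow_le_rpow_of_exponent_le one_le_two ?_
              gcongr
              exact le_max_right _ _

/-- Any matrix becomes singular by changing one row. -/
theorem exists_factorRank_le_pred {R : Type u} [Ring R] {n : ℕ}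
    (F : Matrix (Fin n → Bool) (Fin n → Bool) R) :
    ∃ M : Matrix (Fin n → Bool) (Fin n → Bool) R,
      factorRank M ≤ 2 ^ n - 1 ∧ numDiff F M ≤ 2 ^ n := by
  let x₀ : Fin n → Bool := fun _ => false
  refine ⟨Matrix.of fun x y => if x = x₀ then 0 else F x y, ?_, ?_⟩
  · refine (factorRank_le_of_rows {x₀}ᶜ _ fun x hx y => ?_).trans ?_
    · simp only [Finset.mem_compl, Finset.mem_singleton, not_not] at hx
      simp [hx]
    · simp [Finset.card_compl]
  · have h : ((({x₀} : Finset (Fin n → Bool)) ×ˢ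
        (Finset.univ : Finset (Fin n → Bool))).card) = 2 ^ n := by simp
    rw [← h, ← Set.ncard_coe_finset]
    refine Set.ncard_le_ncard (fun e he => ?_) (Finset.finite_toSet _)
    by_contra hcon
    refine he ?_
    simp only [Finset.coe_product, Finset.coe_singleton, Finset.coe_univ, Set.mem_prod,
      Set.mem_singleton_iff, Set.mem_univ, and_true] at hcon
    simp [hcon]

theorem innerProduct_rigidity {ε : ℝ} (hε : 0 < ε) :
    ∃ δ : ℝ, δ < 1 ∧
      ∀ (R : Type u) [Ring R] (n : ℕ) (f : (Fin n → Bool) → R), IsSymmetricFun f →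
        ∃ M : Matrix (Fin n → Bool) (Fin n → Bool) R,
          (factorRank M : ℝ) ≤ (2 : ℝ) ^ (δ * (n : ℝ)) ∧
          (numDiff (truthTable (innerProductFun f)) M : ℝ) ≤ (2 : ℝ) ^ ((1 + ε) * (n : ℝ)) := by
  obtain ⟨b, hb, hbn⟩ := exists_numSmallSets_le (half_pos hε)
  -- `5 * a ≤ b` bounds each of the two small sets of a wrong entry by 2^(εn/2) choices.
  obtain ⟨a, ha⟩ : ∃ a, a = min (1 / 4) (b / 5) := ⟨_, rfl⟩
  have ha0 : 0 < a := ha ▸ lt_min (by norm_num) (by positivity)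
  have ha4 : a ≤ 1 / 4 := ha ▸ min_le_left _ _
  have hab : a ≤ b / 5 := ha ▸ min_le_right _ _
  obtain ⟨θ, hθ, hθn⟩ := exists_numSmallSets_half_le ha0 (by linarith)
  -- From `N` on, 5 ≤ 2^3 ≤ 2^((1-θ)n/2), which raises the exponent from θ to (1 + θ)/2.
  obtain ⟨N, hN⟩ := exists_nat_ge (3 / ((1 - θ) / 2))
  obtain ⟨δ, hδ, hδn⟩ := exists_rpow_ge_pred N
  refine ⟨max ((1 + θ) / 2) δ, max_lt (by linarith) hδ, fun R _ n f hf => ?_⟩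
  have hn0 : (0 : ℝ) ≤ n := Nat.cast_nonneg n
  rcases Nat.eq_zero_or_pos n with rfl | hn
  · refine ⟨truthTable (innerProductFun f), ?_, by simp [numDiff]⟩
    have := factorRank_le_of_rows Finset.univ (truthTable (innerProductFun f))
      (fun i hi => (hi (Finset.mem_univ i)).elim)
    simpa using this
  rcases lt_or_ge n N with hnN | hnN
  · obtain ⟨M, hM, hM'⟩ := exists_factorRank_le_pred (truthTable (innerProductFun f))
    refine ⟨M, ?_, ?_⟩
    · have h1 : (factorRank M : ℝ) ≤ 2 ^ n - 1 := by
        have h2 : factorRank M + 1 ≤ 2 ^ n := by have := Nat.one_le_two_pow (n := n); omega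
        have h3 : (factorRank M : ℝ) + 1 ≤ 2 ^ n := by exact_mod_cast h2
        linarith
      refine (h1.trans (hδn n hn hnN)).trans (Real.rpow_le_rpow_of_exponent_le one_le_two ?_)
      gcongr
      exact le_max_right _ _
    · have h1 : (numDiff (truthTable (innerProductFun f)) M : ℝ) ≤ 2 ^ (n : ℝ) := by
        rw [Real.rpow_natCast]
        exact_mod_cast hM'
      refine h1.trans (Real.rpow_le_rpow_of_exponent_le one_le_two ?_)
      nlinarith
  · obtain ⟨M, hM, hM'⟩ := exists_innerProduct_approx hf ha0 ha4
    refine ⟨M, ?_, ?_⟩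
    · have h1 : (factorRank M : ℝ) ≤ 5 * numSmallSets n ((1 / 2 - a) * n) := by
        exact_mod_cast hM
      have h3 : 3 ≤ (1 - θ) / 2 * n := by
        have : 3 / ((1 - θ) / 2) ≤ n := hN.trans (Nat.cast_le.2 hnN)
        rwa [div_le_iff₀' (by linarith)] at this
      calc (factorRank M : ℝ) ≤ 2 ^ (3 : ℝ) * 2 ^ (θ * n) := by
            have := hθn n
            norm_num
            linarith
        _ ≤ _ := by
            rw [← Real.rpow_add two_pos]
            refine Real.rpow_le_rpow_of_exponent_le one_le_two ?_
            have := mul_le_mul_of_nonneg_right (le_max_left ((1 + θ) / 2) δ) hn0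
            linarith
    · have h1 : (numDiff (truthTable (innerProductFun f)) M : ℝ)
          ≤ 2 ^ n * (numSmallSets n (5 * a * n) : ℝ) ^ 2 := by exact_mod_cast hM'
      have h2 : (numSmallSets n (5 * a * n) : ℝ) ≤ 2 ^ (ε / 2 * n) := by
        refine le_trans (Nat.cast_le.2 (numSmallSets_mono n ?_)) (hbn n)
        gcongr
        linarith
      calc _ ≤ _ := h1
        _ ≤ 2 ^ (n : ℝ) * (2 ^ (ε / 2 * n)) ^ 2 := by
            rw [Real.rpow_natCast]
            gcongr
        _ = _ := by
            rw [← Real.rpow_natCast (2 ^ (ε / 2 * (n : ℝ))), ← Real.rpow_mul two_pos.le,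
              ← Real.rpow_add two_pos]
            congr 1
            push_cast
            ring

theorem mainTheorem10 :
    -- `IP_f` for symmetric `f`: `δ` depends on `ε` only
    (∃ ε₀ : ℝ, 0 < ε₀ ∧ ∀ ε : ℝ, 0 < ε → ε < ε₀ → ∃ δ : ℝ, δ < 1 ∧
      ∀ (R : Type*) [Ring R] (n : ℕ) (f : (Fin n → Bool) → R), IsSymmetricFun f →
        ∃ M : Matrix (Fin n → Bool) (Fin n → Bool) R,
          (factorRank M : ℝ) ≤ (2 : ℝ) ^ (δ * (n : ℝ)) ∧
          (numDiff (truthTable (innerProductFun f)) M : ℝ) ≤ (2 : ℝ) ^ ((1 + ε) * (n : ℝ))) ∧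
    -- `SYM ∘ AND` circuits with `s` AND gates: the constant `c` is absolute
    (∃ c : ℝ, 0 < c ∧
      ∀ (R : Type*) [Ring R] (n s : ℕ) (f : (Fin n ⊕ Fin n → Bool) → R),
        (∃ C : SymAndCircuit (Fin n ⊕ Fin n) s R, ∀ z, C.eval z = f z) →
        ∀ r : ℕ, 1 ≤ r → r ≤ 2 ^ (2 * n) →
          ∃ M : Matrix (Fin n → Bool) (Fin n → Bool) R,
            (numDiff (truthTable f) M : ℝ) ≤ (2 : ℝ) ^ (2 * n) / (r : ℝ) ∧
            (factorRank M : ℝ) ≤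
              (max 2 ((s : ℝ) / Real.logb 2 r)) ^ (c * Real.sqrt ((s : ℝ) * Real.logb 2 r))) := by
  refine ⟨⟨1, one_pos, fun ε hε _ => innerProduct_rigidity hε⟩, 24, by norm_num, ?_⟩
  intro R _ n s f hf r hr _
  obtain ⟨C, hC⟩ := hf
  exact symAnd_rigidity C hC hr
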